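/- Let $f:\mathbb R\to\mathbb C$ be $2\pi$-periodic and integrable over a period. Write $\|g\|=\int_{-\pi}^{\pi}|g(x)|\,dx$, $\hat f(k)=\frac1{2\pi}\int_{-\pi}^{\pi}f(x)e^{-ikx}\,dx$ for $k\in\mathbb Z$, $S_n(f,x)=\sum_{k=-n}^{n}\hat f(k)e^{ikx}$, and $$E_n(f)_L=\inf_{c_{-n},\dots,c_n\in\mathbb C}\Big\|f-\sum_{k=-n}^{n}c_ke^{ikx}\Big\| .$$ A complex sequence $\mathbf c=\{c_n\}_{n\ge1}$ is said to belong to the class GBV if there is $\theta_1\in[0,\pi/2)$ such that, for every $n\ge1$, $c_n=0$ or $|\arg c_n|\le\theta_1$, and if there are an integer $N_0\ge1$ and a constant $M>0$ such that $$\sum_{n=m}^{2m}|c_n-c_{n+1}|\le M\max_{m\le n<m+N_0}|c_n|\qquad\text{for all } m=1,2,\dots$$ (for a sequence that also has a term of index $0$, that term is not constrained). Suppose that both $\{\hat f(n)\}_{n\ge0}$ and $\{\hat f(-n)\}_{n\ge1}$ belong to GBV, and let $\{\psi_n\}$ be a decreasing (that is, non-increasing) real sequence tending to $0$ with $\psi_n=O(\psi_{2n})$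 as $n\to\infty$. Then $$\|f-S_n(f)\|=O(\psi_n)\quad(n\to\infty)$$ if and only if both $$E_n(f)_L=O(\psi_n)\quad(n\to\infty)\qquad\text{and}\qquad \hat f(n)\log|n|=O(\psi_{|n|})\quad(n\in\mathbb Z,\ |n|\to\infty).$$ -/

import Mathlib

open Filter Asymptotics MeasureTheory
open scoped Real NNReal

noncomputable section

/-- Membership in `L_{2π}`: complex-valued functions of period `2π`, integrable over a period. -/
structure MemL2pi (f : ℝ → ℂ) : Prop where
  periodic : Function.Periodic f (2 * π)
  integrable : IntervalIntegrable f volume (-π) π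

/-- The norm `‖f‖ = ∫_{-π}^{π} |f(x)| dx`. -/
def normL (f : ℝ → ℂ) : ℝ := ∫ x in (-π)..π, ‖f x‖

/-- The Fourier coefficient `(2π)⁻¹ ∫_{-π}^{π} f(x) e^{-ikx} dx`. -/
def fhat (f : ℝ → ℂ) (k : ℤ) : ℂ :=
  fourierCoeffOn (neg_lt_self Real.pi_pos) f k

/-- The trigonometric polynomial `∑_{k=-n}^{n} c_k e^{ikx}`. -/
def trigPoly (n : ℕ) (c : ℤ → ℂ) (x : ℝ) : ℂ :=
  ∑ k ∈ Finset.Icc (-(n : ℤ)) n, c k * Complex.exp (Complex.I * k * x)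

/-- The `n`th partial sum `S_n(f, x)` of the Fourier series. -/
def partialSum (n : ℕ) (f : ℝ → ℂ) : ℝ → ℂ := trigPoly n (fhat f)

/-- The best approximation `E_n(f)_L` by trigonometric polynomials of degree `n`. -/
def bestApprox (n : ℕ) (f : ℝ → ℂ) : ℝ := ⨅ c : ℤ → ℂ, normL (f - trigPoly n c)

/-- The sector `K(θ) = {z : |arg z| ≤ θ}`; for `θ ≥ 0` it contains `0`, as `arg 0 = 0`. -/
def sector (θ : ℝ) : Set ℂ := {z | |Complex.arg z| ≤ θ}

/-- The class GBV. Only the terms `c 1, c 2, …` matter: the term `c 0` is unconstrained. -/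
def GBV (c : ℕ → ℂ) : Prop :=
  (∃ θ : ℝ, 0 ≤ θ ∧ θ < π / 2 ∧ ∀ n : ℕ, 1 ≤ n → c n ∈ sector θ) ∧
  ∃ N₀ : ℕ, 1 ≤ N₀ ∧ ∃ M : ℝ, 0 < M ∧ ∀ m : ℕ, 1 ≤ m →
    ∑ n ∈ Finset.Icc m (2 * m), ‖c n - c (n + 1)‖ ≤
      M * (((Finset.Ico m (m + N₀)).sup fun n => ‖c n‖₊ : ℝ≥0) : ℝ)

end

/-! Necessity. Test `f - S_n(f)` against `e^{±inx}` times the partial sum `∑_{0<|k|≤2n} e^{ikx} / k`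
of the sawtooth series, which is bounded uniformly in `n`: for `c_k = f̂(±k)` this shows that
`∑_{k=1}^{2n} c_{n+k} / k` is `O(‖f - S_n(f)‖)`. The `c_k` lie in a sector of opening less than `π`,
so nothing cancels and the `c_{n+k}` may be replaced by their moduli. Group bounded variation bounds
`|c_{2n}|` and `|c_{2n+1}|` by the moduli near any `n + k` with `1 ≤ k ≤ n`, and the weights `1 / k`
add up to `log n`.

Sufficiency. The de la Vallée-Poussin mean `V_n(f)` is within `4 E_n(f)` of `f`. Summation by parts
bounds `V_n(f) - S_n(f)` at `x` by a multiple of `(ψ_n / log n) · n / (1 + n|x|)`, and the integral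
of `n / (1 + n|x|)` is of order `log n`. -/

open Complex Finset

/-! ### Summation by parts -/

section SummationByParts

variable {R E : Type*} [SeminormedRing R] [SeminormedAddCommGroup E] [Module R E]

theorem norm_sum_range_smul_le [IsBoundedSMul R E] (f : ℕ → R) (g : ℕ → E) {n : ℕ} {B : ℝ}
    (hB : ∀ i ≤ n, ‖∑ k ∈ range i, g k‖ ≤ B) :
    ‖∑ k ∈ range n, f k • g k‖ ≤ (‖f n‖ + ∑ k ∈ range n, ‖f k - f (k + 1)‖) * B := by
  have by_parts : ∑ k ∈ range n, f k • g k =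
      f n • ∑ k ∈ range n, g k +
        ∑ k ∈ range n, (f k - f (k + 1)) • ∑ i ∈ range (k + 1), g i := by
    have h := sum_range_by_parts f g (n + 1)
    rw [sum_range_succ, Nat.add_sub_cancel, sum_range_succ g, smul_add, add_sub_right_comm] at h
    rw [add_right_cancel h, sub_eq_add_neg, ← sum_neg_distrib]
    simp only [← neg_smul, neg_sub]
  rw [by_parts, add_mul, sum_mul]
  refine norm_add_le_of_le ?_ (norm_sum_le_of_le _ fun k hk => ?_)
  · exact (norm_smul_le _ _).trans (by gcongr; exact hB n le_rfl)
  · exact (norm_smul_le _ _).trans (by gcongr; exact hB _ (mem_range.1 hk))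

theorem norm_sum_Ico_smul_le [IsBoundedSMul R E] (f : ℕ → R) (g : ℕ → E) {a b : ℕ} (hab : a ≤ b)
    {B : ℝ} (hB : ∀ i ≤ b, ‖∑ k ∈ Ico a i, g k‖ ≤ B) :
    ‖∑ k ∈ Ico a b, f k • g k‖ ≤ (‖f b‖ + ∑ k ∈ Ico a b, ‖f k - f (k + 1)‖) * B := by
  have h := norm_sum_range_smul_le (fun k => f (a + k)) (fun k => g (a + k)) (n := b - a) (B := B)
    fun i hi => by simpa [sum_Ico_eq_sum_range] using hB (a + i) (by lia)
  simpa only [sum_Ico_eq_sum_range, Nat.add_sub_of_le hab, add_assoc] using h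

theorem norm_sum_Ico_smul_le_of_antitoneOn [NormedSpace ℝ E] {f : ℕ → ℝ} (g : ℕ → E) {a b : ℕ}
    (hab : a ≤ b) (hf : AntitoneOn f (Set.Icc a b)) (hfb : 0 ≤ f b) {B : ℝ}
    (hB : ∀ i ≤ b, ‖∑ k ∈ Ico a i, g k‖ ≤ B) :
    ‖∑ k ∈ Ico a b, f k • g k‖ ≤ f a * B := by
  have telescope : ∑ k ∈ Ico a b, ‖f k - f (k + 1)‖ = f a - f b := by
    rw [← neg_sub (f b), ← sum_Ico_sub f hab, ← sum_neg_distrib]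
    refine sum_congr rfl fun k hk => ?_
    rw [mem_Ico] at hk
    rw [neg_sub, Real.norm_of_nonneg (sub_nonneg.2 (hf ⟨hk.1, hk.2.le⟩ ⟨by lia, hk.2⟩ k.le_succ))]
  have h := norm_sum_Ico_smul_le f g hab hB
  rwa [telescope, Real.norm_of_nonneg hfb, add_sub_cancel] at h

end SummationByParts

/-! ### Exponential sums and the sawtooth series -/

theorem norm_geom_sum_Ico_mul_le {𝕜 : Type*} [NormedDivisionRing 𝕜] {z : 𝕜} (hz : ‖z‖ ≤ 1)
    (a b : ℕ) : ‖∑ k ∈ Ico a b, z ^ k‖ * ‖z - 1‖ ≤ 2 := by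
  rcases le_total b a with hba | hab
  · simp [Ico_eq_empty_of_le hba]
  · have norm_pow_le (k : ℕ) : ‖z ^ k‖ ≤ 1 := by
      rw [norm_pow]; exact pow_le_one₀ (norm_nonneg z) hz
    rw [← norm_mul, geom_sum_Ico_mul z hab, ← one_add_one_eq_two]
    exact norm_sub_le_of_le (norm_pow_le b) (norm_pow_le a)

theorem two_div_pi_mul_abs_le_norm_exp_sub_one {x : ℝ} (hx : |x| ≤ π) :
    2 / π * |x| ≤ ‖exp (I * x) - 1‖ := by
  have h : 2 / π * |x / 2| ≤ |Real.sin (x / 2)| :=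
    Real.mul_abs_le_abs_sin (by rw [abs_div, abs_two]; linarith)
  rw [norm_exp_I_mul_ofReal_sub_one, norm_mul, Real.norm_eq_abs, Real.norm_eq_abs, abs_two]
  rw [abs_div, abs_two] at h
  linarith

theorem norm_sum_exp_pow_mul_abs_le {x : ℝ} (hx : |x| ≤ π) (a b : ℕ) :
    ‖∑ k ∈ Ico a b, exp (I * x) ^ k‖ * |x| ≤ π := by
  calc ‖∑ k ∈ Ico a b, exp (I * x) ^ k‖ * |x|
      = π / 2 * (‖∑ k ∈ Ico a b, exp (I * x) ^ k‖ * (2 / π * |x|)) := by field_simp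
    _ ≤ π / 2 * (‖∑ k ∈ Ico a b, exp (I * x) ^ k‖ * ‖exp (I * x) - 1‖) := by
        gcongr; exact two_div_pi_mul_abs_le_norm_exp_sub_one hx
    _ ≤ π / 2 * 2 := by
        gcongr; exact norm_geom_sum_Ico_mul_le (norm_exp_I_mul_ofReal x).le a b
    _ = π := by ring

theorem norm_sum_exp_pow_le {x : ℝ} (hx : |x| ≤ π) {a b n : ℕ} (hab : b ≤ a + n) :
    ‖∑ k ∈ Ico a b, exp (I * x) ^ k‖ ≤ (1 + π) * (n / (1 + n * |x|)) := by
  have trivial_bound : ‖∑ k ∈ Ico a b, exp (I * x) ^ k‖ ≤ n := by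
    calc ‖∑ k ∈ Ico a b, exp (I * x) ^ k‖ ≤ ∑ _k ∈ Ico a b, (1 : ℝ) :=
          norm_sum_le_of_le _ fun k _ => by rw [norm_pow, norm_exp_I_mul_ofReal, one_pow]
      _ = (b - a : ℕ) := by simp
      _ ≤ n := by exact_mod_cast Nat.sub_le_iff_le_add'.2 hab
  have decay_bound := norm_sum_exp_pow_mul_abs_le hx a b
  rw [← mul_div_assoc, le_div_iff₀ (by positivity)]
  nlinarith [Nat.cast_nonneg (α := ℝ) n]

theorem exp_I_mul_pow_im (x : ℝ) (k : ℕ) : (exp (I * x) ^ k).im = Real.sin (k * x) := by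
  rw [← exp_nat_mul, mul_left_comm, mul_comm I, ← ofReal_natCast, ← ofReal_mul, exp_ofReal_mul_I_im]

theorem abs_sum_sin_div_le_mul_abs (x : ℝ) (n : ℕ) :
    |∑ k ∈ Ico 1 (n + 1), Real.sin (k * x) / k| ≤ n * |x| := by
  calc |∑ k ∈ Ico 1 (n + 1), Real.sin (k * x) / k| ≤ ∑ _k ∈ Ico 1 (n + 1), |x| := by
        refine (abs_sum_le_sum_abs _ _).trans (sum_le_sum fun k hk => ?_)
        have hk : (0 : ℝ) < k := by exact_mod_cast (mem_Ico.1 hk).1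
        rw [abs_div, abs_of_pos hk, div_le_iff₀' hk]
        exact Real.abs_sin_le_abs.trans_eq (by rw [abs_mul, abs_of_pos hk])
    _ = n * |x| := by simp

theorem abs_sum_sin_div_mul_abs_le {x : ℝ} (hx : |x| ≤ π) {a b : ℕ} (ha : 0 < a) (hab : a ≤ b) :
    |∑ k ∈ Ico a b, Real.sin (k * x) / k| * |x| ≤ π / a := by
  rcases eq_or_ne x 0 with rfl | hx0
  · simp only [abs_zero, mul_zero]; positivity
  have hx_pos : 0 < |x| := abs_pos.2 hx0
  have hanti : AntitoneOn (fun k : ℕ => (k : ℝ)⁻¹) (Set.Icc a b) := fun i hi j _ hij =>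
    inv_anti₀ (by exact_mod_cast ha.trans_le hi.1) (by exact_mod_cast hij)
  have h := norm_sum_Ico_smul_le_of_antitoneOn (fun k => exp (I * x) ^ k) hab hanti (by positivity)
    fun i _ => (le_div_iff₀ hx_pos).2 (norm_sum_exp_pow_mul_abs_le hx a i)
  have him : ∑ k ∈ Ico a b, Real.sin (k * x) / k =
      (∑ k ∈ Ico a b, (k : ℝ)⁻¹ • exp (I * x) ^ k).im := by
    simp only [im_sum, smul_im, exp_I_mul_pow_im, smul_eq_mul, div_eq_inv_mul]
  calc |∑ k ∈ Ico a b, Real.sin (k * x) / k| * |x| ≤ (a : ℝ)⁻¹ * (π / |x|) * |x| := by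
        rw [him]; gcongr; exact (abs_im_le_norm _).trans h
    _ = π / a := by field_simp

theorem abs_sum_sin_div_le {x : ℝ} (hx : |x| ≤ π) (n : ℕ) :
    |∑ k ∈ Ico 1 (n + 1), Real.sin (k * x) / k| ≤ 1 + π := by
  rcases eq_or_ne x 0 with rfl | hx0
  · simpa using add_nonneg zero_le_one Real.pi_pos.le
  have hx_pos : 0 < |x| := abs_pos.2 hx0
  -- Below the frequency `1 / |x|` the terms are at most `|x|`; beyond it they oscillate.
  set m := ⌊1 / |x|⌋₊
  have hm : m * |x| ≤ 1 := (le_div_iff₀ hx_pos).1 (Nat.floor_le (by positivity))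
  have hm' : 1 ≤ (m + 1 : ℕ) * |x| := by
    rw [← div_le_iff₀ hx_pos]; exact_mod_cast (Nat.lt_floor_add_one (1 / |x|)).le
  rcases le_total n m with hnm | hmn
  · calc |∑ k ∈ Ico 1 (n + 1), Real.sin (k * x) / k| ≤ n * |x| := abs_sum_sin_div_le_mul_abs x n
      _ ≤ m * |x| := by gcongr
      _ ≤ 1 + π := by linarith [Real.pi_pos]
  · have head := (abs_sum_sin_div_le_mul_abs x m).trans hm
    have tail : |∑ k ∈ Ico (m + 1) (n + 1), Real.sin (k * x) / k| ≤ π := by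
      refine le_of_mul_le_mul_right ?_ hx_pos
      calc |∑ k ∈ Ico (m + 1) (n + 1), Real.sin (k * x) / k| * |x| ≤ π / (m + 1 : ℕ) :=
            abs_sum_sin_div_mul_abs_le hx m.succ_pos (by lia)
        _ ≤ π * |x| := by
            rw [div_le_iff₀ (by positivity), mul_assoc, mul_comm |x|]
            exact le_mul_of_one_le_right Real.pi_pos.le hm'
    rw [← sum_Ico_consecutive _ (by lia : 1 ≤ m + 1) (by lia : m + 1 ≤ n + 1)]
    exact (abs_add_le _ _).trans (add_le_add head tail)

theorem continuous_div_one_add_mul_abs {r : ℝ} (hr : 0 ≤ r) :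
    Continuous fun x : ℝ => r / (1 + r * |x|) :=
  continuous_const.div (by fun_prop) fun x => by positivity

theorem integral_div_one_add_mul_abs {r a : ℝ} (hr : 0 ≤ r) (ha : 0 ≤ a) :
    ∫ x in (-a)..a, r / (1 + r * |x|) = 2 * Real.log (1 + r * a) := by
  have hint (u v : ℝ) : IntervalIntegrable (fun x => r / (1 + r * |x|)) volume u v :=
    (continuous_div_one_add_mul_abs hr).intervalIntegrable u v
  have right_half : ∫ x in 0..a, r / (1 + r * |x|) = Real.log (1 + r * a) := by
    have hderiv : ∀ x ∈ Set.uIcc 0 a,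
        HasDerivAt (fun x => Real.log (1 + r * x)) (r / (1 + r * |x|)) x := fun x hx => by
      rw [Set.uIcc_of_le ha] at hx
      have hx0 : 0 ≤ x := hx.1
      rw [abs_of_nonneg hx0]
      exact (((hasDerivAt_id x).const_mul r).const_add 1).log (by positivity) |>.congr_deriv
        (by simp)
    simpa using intervalIntegral.integral_eq_sub_of_hasDerivAt hderiv (hint 0 a)
  have left_half : ∫ x in (-a)..0, r / (1 + r * |x|) = Real.log (1 + r * a) := by
    rw [← right_half, ← neg_zero, ← intervalIntegral.integral_comp_neg]
    simp only [abs_neg, neg_zero]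
  rw [← intervalIntegral.integral_add_adjacent_intervals (hint _ 0) (hint 0 _), left_half,
    right_half, two_mul]

theorem log_one_add_mul_pi_le {n : ℕ} (hn : 2 ≤ n) : Real.log (1 + n * π) ≤ 4 * Real.log n := by
  have hn' : (2 : ℝ) ≤ n := by exact_mod_cast hn
  have eight_le : (2 : ℝ) ^ 3 ≤ n ^ 3 := by gcongr
  calc Real.log (1 + n * π) ≤ Real.log (n ^ 4) := by
        gcongr
        nlinarith [Real.pi_le_four]
    _ = 4 * Real.log n := by rw [Real.log_pow]; norm_num

/-! ### Fourier coefficients and trigonometric polynomials -/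

theorem fhat_eq_integral (f : ℝ → ℂ) (k : ℤ) :
    fhat f k = (2 * π)⁻¹ • ∫ x in (-π)..π, f x * exp (-(I * k * x)) := by
  have hexp (x : ℝ) : fourier (-k) (x : AddCircle (π - -π)) = exp (-(I * k * x)) := by
    have hπ : (π : ℂ) ≠ 0 := by exact_mod_cast Real.pi_ne_zero
    rw [fourier_coe_apply]
    push_cast
    congr 1
    field_simp
    ring
  simp only [fhat, fourierCoeffOn_eq_integral, hexp, smul_eq_mul, mul_comm (f _)]
  congr 1
  ring

theorem intervalIntegrable_mul_exp {f : ℝ → ℂ} (hf : IntervalIntegrable f volume (-π) π) (k : ℤ) :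
    IntervalIntegrable (fun x : ℝ => f x * exp (-(I * k * x))) volume (-π) π :=
  hf.mul_continuousOn (by fun_prop)

theorem fhat_sub {f g : ℝ → ℂ} (hf : IntervalIntegrable f volume (-π) π)
    (hg : IntervalIntegrable g volume (-π) π) (k : ℤ) :
    fhat (f - g) k = fhat f k - fhat g k := by
  simp only [fhat_eq_integral, Pi.sub_apply, sub_mul]
  rw [intervalIntegral.integral_sub (intervalIntegrable_mul_exp hf k)
    (intervalIntegrable_mul_exp hg k), smul_sub]

theorem fhat_one (k : ℤ) : fhat 1 k = if k = 0 then 1 else 0 := by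
  rw [fhat_eq_integral]
  split_ifs with hk
  · have hπ : (π : ℂ) ≠ 0 := by exact_mod_cast Real.pi_ne_zero
    simp [hk, field, ← two_mul]
  · have hc : -(I * k) ≠ 0 := neg_ne_zero.2 (mul_ne_zero I_ne_zero (by exact_mod_cast hk))
    have hper : exp (-(I * k) * (π : ℝ)) = exp (-(I * k) * (-π : ℝ)) :=
      exp_eq_exp_iff_exists_int.2 ⟨-k, by push_cast; ring⟩
    simp only [Pi.one_apply, one_mul, ← neg_mul (I * (k : ℂ)), integral_exp_mul_complex hc, hper,
      sub_self, zero_div, smul_zero]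

theorem normL_nonneg (g : ℝ → ℂ) : 0 ≤ normL g :=
  intervalIntegral.integral_nonneg (neg_le_self Real.pi_pos.le) fun _ _ => norm_nonneg _

theorem normL_sub_rev (g h : ℝ → ℂ) : normL (g - h) = normL (h - g) := by
  simp only [normL, Pi.sub_apply, norm_sub_rev]

theorem normL_sub_le {g h : ℝ → ℂ} (hg : IntervalIntegrable g volume (-π) π)
    (hh : IntervalIntegrable h volume (-π) π) : normL (g - h) ≤ normL g + normL h := by
  unfold normL
  rw [← intervalIntegral.integral_add hg.norm hh.norm]
  exact intervalIntegral.integral_mono_on (neg_le_self Real.pi_pos.le) (hg.sub hh).norm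
    (hg.norm.add hh.norm) fun x _ => norm_sub_le _ _

theorem normL_const_smul (a : ℂ) (g : ℝ → ℂ) : normL (a • g) = ‖a‖ * normL g := by
  simp only [normL, Pi.smul_apply, norm_smul, intervalIntegral.integral_const_mul]

theorem normL_le_integral {g : ℝ → ℂ} (hg : IntervalIntegrable g volume (-π) π) {b : ℝ → ℝ}
    (hb : IntervalIntegrable b volume (-π) π) (hgb : ∀ x ∈ Set.Icc (-π) π, ‖g x‖ ≤ b x) :
    normL g ≤ ∫ x in (-π)..π, b x :=
  intervalIntegral.integral_mono_on (neg_le_self Real.pi_pos.le) hg.norm hb hgb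

theorem norm_fhat_le (g : ℝ → ℂ) (k : ℤ) : ‖fhat g k‖ ≤ (2 * π)⁻¹ * normL g := by
  have hexp (x : ℝ) : ‖exp (-(I * k * x))‖ = 1 := by
    rw [show -(I * k * x) = I * (-k * x : ℝ) by push_cast; ring, norm_exp_I_mul_ofReal]
  rw [fhat_eq_integral, norm_smul, Real.norm_of_nonneg (by positivity)]
  gcongr
  refine (intervalIntegral.norm_integral_le_integral_norm (neg_le_self Real.pi_pos.le)).trans_eq ?_
  simp only [norm_mul, hexp, mul_one, normL]

theorem continuous_trigPoly (n : ℕ) (c : ℤ → ℂ) : Continuous (trigPoly n c) := by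
  unfold trigPoly
  fun_prop

theorem intervalIntegrable_trigPoly (n : ℕ) (c : ℤ → ℂ) :
    IntervalIntegrable (trigPoly n c) volume (-π) π :=
  (continuous_trigPoly n c).intervalIntegrable _ _

theorem fhat_mul_trigPoly {g : ℝ → ℂ} (hg : IntervalIntegrable g volume (-π) π) (n : ℕ)
    (c : ℤ → ℂ) (m : ℤ) :
    fhat (g * trigPoly n c) m = ∑ k ∈ Icc (-(n : ℤ)) n, c k * fhat g (m - k) := by
  have expand (x : ℝ) : (g * trigPoly n c) x * exp (-(I * m * x)) =
      ∑ k ∈ Icc (-(n : ℤ)) n, c k * (g x * exp (-(I * (m - k : ℤ) * x))) := by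
    rw [Pi.mul_apply, trigPoly, mul_sum, sum_mul]
    refine sum_congr rfl fun k _ => ?_
    rw [show -(I * (m - k : ℤ) * x) = I * k * x + -(I * m * x) by push_cast; ring, exp_add]
    ring
  simp only [fhat_eq_integral, expand]
  rw [intervalIntegral.integral_finsetSum
    fun k _ => (intervalIntegrable_mul_exp hg (m - k)).const_mul (c k), smul_sum]
  simp only [intervalIntegral.integral_const_mul, mul_smul_comm]

theorem fhat_trigPoly (n : ℕ) (c : ℤ → ℂ) (k : ℤ) :
    fhat (trigPoly n c) k = if k ∈ Icc (-(n : ℤ)) n then c k else 0 := by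
  have hone : IntervalIntegrable (1 : ℝ → ℂ) volume (-π) π := intervalIntegrable_const
  rw [← one_mul (trigPoly n c), fhat_mul_trigPoly hone]
  simp only [fhat_one, sub_eq_zero, mul_ite, mul_one, mul_zero, sum_ite_eq]

theorem sum_Icc_neg_natCast {M : Type*} [AddCommGroup M] (a : ℤ → M) (n : ℕ) :
    ∑ k ∈ Icc (-(n : ℤ)) n, a k = a 0 + ∑ k ∈ Ico 1 (n + 1), (a k + a (-k)) := by
  induction n with
  | zero => simp
  | succ n ih =>
    rw [Nat.cast_succ, sum_Icc_succ_eq_add_endpoints, ih, sum_Ico_succ_top (by lia : 1 ≤ n + 1),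
      Nat.cast_succ]
    abel

theorem trigPoly_eq_add_sum (n : ℕ) (c : ℤ → ℂ) (x : ℝ) :
    trigPoly n c x = c 0 + ∑ k ∈ Ico 1 (n + 1),
      (c k * exp (I * x) ^ k + c (-k) * exp (I * (-x : ℝ)) ^ k) := by
  rw [trigPoly, sum_Icc_neg_natCast]
  simp only [← exp_nat_mul]
  push_cast
  ring_nf
  simp

theorem trigPoly_zero (c : ℤ → ℂ) (x : ℝ) : trigPoly 0 c x = c 0 := by
  simp [trigPoly]

theorem trigPoly_succ (n : ℕ) (c : ℤ → ℂ) (x : ℝ) :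
    trigPoly (n + 1) c x = trigPoly n c x + (c (n + 1 : ℕ) * exp (I * x) ^ (n + 1) +
      c (-(n + 1 : ℕ)) * exp (I * (-x : ℝ)) ^ (n + 1)) := by
  rw [trigPoly_eq_add_sum, trigPoly_eq_add_sum, sum_Ico_succ_top (by lia), add_assoc]

theorem trigPoly_sub_trigPoly {n j : ℕ} (hnj : n ≤ j) (c : ℤ → ℂ) (x : ℝ) :
    trigPoly j c x - trigPoly n c x =
      ∑ k ∈ Ico (n + 1) (j + 1), c k * exp (I * x) ^ k +
      ∑ k ∈ Ico (n + 1) (j + 1), c (-k) * exp (I * (-x : ℝ)) ^ k := by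
  rw [trigPoly_eq_add_sum, trigPoly_eq_add_sum, add_sub_add_left_eq_sub, ← sum_add_distrib,
    ← sum_Ico_consecutive _ (by lia : 1 ≤ n + 1) (by lia : n + 1 ≤ j + 1), add_sub_cancel_left]

theorem norm_trigPoly_inv_le {x : ℝ} (hx : |x| ≤ π) (n : ℕ) :
    ‖trigPoly n (fun k => (k : ℂ)⁻¹) x‖ ≤ 2 * (1 + π) := by
  have hsin : trigPoly n (fun k => (k : ℂ)⁻¹) x =
      2 * I * (∑ k ∈ Ico 1 (n + 1), Real.sin (k * x) / k : ℝ) := by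
    rw [trigPoly_eq_add_sum, Int.cast_zero, inv_zero, zero_add, ofReal_sum, mul_sum]
    refine sum_congr rfl fun k _ => ?_
    have two_I_mul_sin : 2 * I * sin (k * x) = exp (k * x * I) - exp (-(k * x) * I) := by
      rw [sin]
      linear_combination (exp (-(k * x) * I) - exp (k * x * I)) * I_mul_I
    rw [← exp_nat_mul, ← exp_nat_mul]
    push_cast
    rw [mul_div_assoc', two_I_mul_sin, inv_neg]
    ring_nf
  rw [hsin, norm_mul, norm_mul, norm_I, norm_ofNat, mul_one, norm_real]
  gcongr
  exact abs_sum_sin_div_le hx n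

-- The term `k = 0` is zero, as `0⁻¹ = 0`.
theorem norm_sum_inv_mul_fhat_sub_le {g : ℝ → ℂ} (hg : IntervalIntegrable g volume (-π) π) (n : ℕ)
    (m : ℤ) :
    ‖∑ k ∈ Icc (-(n : ℤ)) n, (k : ℂ)⁻¹ * fhat g (m - k)‖ ≤ (1 + π) / π * normL g := by
  set p := trigPoly n fun k => (k : ℂ)⁻¹
  have hp : ContinuousOn p (Set.uIcc (-π) π) := (continuous_trigPoly _ _).continuousOn
  have normL_mul_le : normL (g * p) ≤ 2 * (1 + π) * normL g := by
    rw [normL.eq_def g, ← intervalIntegral.integral_const_mul]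
    refine normL_le_integral (hg.mul_continuousOn hp) (hg.norm.const_mul _) fun x hx => ?_
    rw [norm_mul, mul_comm]
    gcongr
    exact norm_trigPoly_inv_le (abs_le.2 hx) n
  rw [← fhat_mul_trigPoly hg]
  calc ‖fhat (g * p) m‖ ≤ (2 * π)⁻¹ * normL (g * p) := norm_fhat_le _ _
    _ ≤ (2 * π)⁻¹ * (2 * (1 + π) * normL g) := by gcongr
    _ = (1 + π) / π * normL g := by field_simp

/-! ### Fejér's kernel and de la Vallée-Poussin means -/

theorem continuous_partialSum (n : ℕ) (g : ℝ → ℂ) : Continuous (partialSum n g) :=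
  continuous_trigPoly n (fhat g)

theorem continuous_sum_partialSum (s : Finset ℕ) (g : ℝ → ℂ) :
    Continuous (∑ j ∈ s, partialSum j g) := by
  simpa only [Finset.sum_fn] using continuous_finsetSum s fun j _ => continuous_partialSum j g

theorem partialSum_trigPoly {n j : ℕ} (hnj : n ≤ j) (c : ℤ → ℂ) :
    partialSum j (trigPoly n c) = trigPoly n c := by
  funext x
  rw [partialSum, trigPoly.eq_1 j, trigPoly.eq_1 n]
  simp only [fhat_trigPoly, ite_mul, zero_mul]
  rw [sum_ite_mem, inter_eq_right.2 (Icc_subset_Icc (by lia) (by lia))]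

theorem partialSum_sub {f g : ℝ → ℂ} (hf : IntervalIntegrable f volume (-π) π)
    (hg : IntervalIntegrable g volume (-π) π) (n : ℕ) :
    partialSum n (f - g) = partialSum n f - partialSum n g := by
  funext x
  simp only [partialSum, trigPoly, fhat_sub hf hg, sub_mul, sum_sub_distrib, Pi.sub_apply]

theorem integral_partialSum (g : ℝ → ℂ) (n : ℕ) :
    ∫ x in (-π)..π, partialSum n g x = ∫ x in (-π)..π, g x := by
  have hfhat : fhat (partialSum n g) 0 = fhat g 0 := by
    rw [partialSum, fhat_trigPoly, if_pos (by simp)]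
  simpa [fhat_eq_integral, Real.pi_ne_zero] using hfhat

/-- Fejér's kernel `∑_{j<m} D_j`, without the customary factor `1 / m`. The sum of Dirichlet kernels
is `sum_trigPoly_one`; defining the kernel as a square makes its positivity evident. -/
noncomputable def fejerKernel (m : ℕ) (x : ℝ) : ℝ := ‖∑ j ∈ range m, exp (I * x) ^ j‖ ^ 2

theorem fejerKernel_nonneg (m : ℕ) (x : ℝ) : 0 ≤ fejerKernel m x := sq_nonneg _

theorem exp_I_mul_mul_exp_I_mul_neg (x : ℝ) : exp (I * x) * exp (I * (-x : ℝ)) = 1 := by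
  rw [← exp_add, ← mul_add, ofReal_neg, add_neg_cancel, mul_zero, exp_zero]

theorem trigPoly_one_eq (m : ℕ) (x : ℝ) :
    trigPoly m 1 x = 1 + exp (I * x) ^ m * ∑ j ∈ range m, exp (I * (-x : ℝ)) ^ j +
      exp (I * (-x : ℝ)) ^ m * ∑ j ∈ range m, exp (I * x) ^ j := by
  have hzw := exp_I_mul_mul_exp_I_mul_neg x
  induction m with
  | zero => simp [trigPoly_zero]
  | succ m ih =>
    rw [trigPoly_succ, ih, sum_range_succ', sum_range_succ']
    generalize exp (I * x) = z at *
    generalize exp (I * (-x : ℝ)) = w at *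
    simp only [pow_succ _, ← sum_mul, pow_zero, Pi.one_apply]
    linear_combination (-z ^ m * (∑ i ∈ range m, w ^ i) - w ^ m * (∑ i ∈ range m, z ^ i)) * hzw

theorem sum_trigPoly_one (m : ℕ) (x : ℝ) :
    ∑ j ∈ range m, trigPoly j 1 x = fejerKernel m x := by
  have hconj : starRingEnd ℂ (exp (I * x)) = exp (I * (-x : ℝ)) := by
    rw [← exp_conj, map_mul, conj_I, conj_ofReal, ofReal_neg, neg_mul, mul_neg]
  rw [fejerKernel, ofReal_pow, ← mul_conj', map_sum]
  simp only [map_pow, hconj]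
  induction m with
  | zero => simp
  | succ m ih =>
    have hpow : exp (I * x) ^ m * exp (I * (-x : ℝ)) ^ m = 1 := by
      rw [← mul_pow, exp_I_mul_mul_exp_I_mul_neg, one_pow]
    rw [sum_range_succ, ih, trigPoly_one_eq, sum_range_succ, sum_range_succ]
    linear_combination -hpow

theorem partialSum_eq_integral {g : ℝ → ℂ} (hg : IntervalIntegrable g volume (-π) π) (n : ℕ)
    (x : ℝ) :
    partialSum n g x = (2 * π)⁻¹ • ∫ t in (-π)..π, g t * trigPoly n 1 (x - t) := by
  simp only [partialSum, trigPoly, mul_sum]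
  rw [intervalIntegral.integral_finsetSum
    fun j _ => hg.mul_continuousOn (Continuous.continuousOn (by fun_prop)), smul_sum]
  refine sum_congr rfl fun k _ => ?_
  rw [fhat_eq_integral, smul_mul_assoc, ← intervalIntegral.integral_mul_const]
  congr 2 with t
  rw [Pi.one_apply, one_mul, mul_assoc, ← exp_add]
  push_cast
  ring_nf

theorem sum_partialSum_eq_integral {g : ℝ → ℂ} (hg : IntervalIntegrable g volume (-π) π) (m : ℕ)
    (x : ℝ) :
    (∑ j ∈ range m, partialSum j g) x =
      (2 * π)⁻¹ • ∫ t in (-π)..π, g t * fejerKernel m (x - t) := by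
  have hint (j : ℕ) : IntervalIntegrable (fun t => g t * trigPoly j 1 (x - t)) volume (-π) π :=
    hg.mul_continuousOn ((continuous_trigPoly j 1).comp (continuous_sub_left x)).continuousOn
  simp only [Finset.sum_apply, partialSum_eq_integral hg, ← smul_sum, ← sum_trigPoly_one, mul_sum]
  rw [intervalIntegral.integral_finsetSum fun j _ => hint j]

theorem norm_sum_partialSum_le {g : ℝ → ℂ} (hg : IntervalIntegrable g volume (-π) π) (m : ℕ)
    (x : ℝ) :
    ‖(∑ j ∈ range m, partialSum j g) x‖ ≤
      ((∑ j ∈ range m, partialSum j fun t => (‖g t‖ : ℂ)) x).re := by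
  have hg_norm : IntervalIntegrable (fun t => (‖g t‖ : ℂ)) volume (-π) π :=
    ⟨hg.norm.1.ofReal, hg.norm.2.ofReal⟩
  rw [sum_partialSum_eq_integral hg, sum_partialSum_eq_integral hg_norm, norm_smul, smul_re,
    Real.norm_of_nonneg (by positivity)]
  simp only [← ofReal_mul, intervalIntegral.integral_ofReal, ofReal_re, smul_eq_mul]
  gcongr
  refine (intervalIntegral.norm_integral_le_integral_norm
    (neg_le_self Real.pi_pos.le)).trans_eq ?_
  simp only [norm_mul, norm_real, Real.norm_of_nonneg (fejerKernel_nonneg _ _)]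

-- Integrating the partial sums of `|g|` takes the place of an appeal to Fubini's theorem.
theorem normL_sum_partialSum_le {g : ℝ → ℂ} (hg : IntervalIntegrable g volume (-π) π) (m : ℕ) :
    normL (∑ j ∈ range m, partialSum j g) ≤ m * normL g := by
  have hcont (h : ℝ → ℂ) := continuous_sum_partialSum (range m) h
  calc normL (∑ j ∈ range m, partialSum j g)
      ≤ ∫ x in (-π)..π, ((∑ j ∈ range m, partialSum j fun t => (‖g t‖ : ℂ)) x).re :=
        normL_le_integral ((hcont g).intervalIntegrable _ _)
          ((continuous_re.comp (hcont _)).intervalIntegrable _ _)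
          fun x _ => norm_sum_partialSum_le hg m x
    _ = (∫ x in (-π)..π, (∑ j ∈ range m, partialSum j fun t => (‖g t‖ : ℂ)) x).re :=
        intervalIntegral.intervalIntegral_re ((hcont _).intervalIntegrable _ _)
    _ = m * normL g := by
        simp only [Finset.sum_apply]
        rw [intervalIntegral.integral_finsetSum
          fun j _ => (continuous_partialSum j _).intervalIntegrable _ _]
        simp only [integral_partialSum, intervalIntegral.integral_ofReal, sum_const, card_range]
        rw [nsmul_eq_mul, ← ofReal_natCast, ← ofReal_mul, ofReal_re, normL]

/-- The de la Vallée-Poussin mean `n⁻¹ ∑_{j=n}^{2n-1} S_j(f)`: it fixes trigonometric polynomials of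
degree `n` and is bounded on `L`, hence approximates `f` almost as well as possible. -/
noncomputable def vallPoussin (n : ℕ) (f : ℝ → ℂ) : ℝ → ℂ :=
  (n : ℂ)⁻¹ • ∑ j ∈ Ico n (2 * n), partialSum j f

theorem continuous_vallPoussin (n : ℕ) (f : ℝ → ℂ) : Continuous (vallPoussin n f) :=
  (continuous_sum_partialSum _ f).const_smul _

theorem intervalIntegrable_vallPoussin (n : ℕ) (f : ℝ → ℂ) :
    IntervalIntegrable (vallPoussin n f) volume (-π) π :=
  (continuous_vallPoussin n f).intervalIntegrable _ _

theorem normL_vallPoussin_le {n : ℕ} (hn : n ≠ 0) {g : ℝ → ℂ}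
    (hg : IntervalIntegrable g volume (-π) π) : normL (vallPoussin n g) ≤ 3 * normL g := by
  have hint (m : ℕ) : IntervalIntegrable (∑ j ∈ range m, partialSum j g) volume (-π) π :=
    (continuous_sum_partialSum _ g).intervalIntegrable _ _
  rw [vallPoussin, normL_const_smul, norm_inv, Complex.norm_natCast,
    sum_Ico_eq_sub _ (by lia : n ≤ 2 * n)]
  calc (n : ℝ)⁻¹ * normL (∑ j ∈ range (2 * n), partialSum j g - ∑ j ∈ range n, partialSum j g)
      ≤ (n : ℝ)⁻¹ * ((2 * n : ℕ) * normL g + n * normL g) := by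
        gcongr
        exact (normL_sub_le (hint _) (hint _)).trans
          (add_le_add (normL_sum_partialSum_le hg _) (normL_sum_partialSum_le hg _))
    _ = 3 * normL g := by push_cast; field

theorem inv_natCast_smul_sum_Ico_const {E : Type*} [AddCommGroup E] [Module ℂ E] {n : ℕ}
    (hn : n ≠ 0) (a : E) : (n : ℂ)⁻¹ • ∑ _j ∈ Ico n (2 * n), a = a := by
  rw [sum_const, Nat.card_Ico, two_mul, Nat.add_sub_cancel, ← Nat.cast_smul_eq_nsmul ℂ,
    inv_smul_smul₀ (Nat.cast_ne_zero.2 hn)]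

theorem vallPoussin_trigPoly {n : ℕ} (hn : n ≠ 0) (c : ℤ → ℂ) :
    vallPoussin n (trigPoly n c) = trigPoly n c := by
  rw [vallPoussin, sum_congr rfl fun j hj => partialSum_trigPoly (mem_Ico.1 hj).1 c,
    inv_natCast_smul_sum_Ico_const hn]

theorem vallPoussin_sub {f g : ℝ → ℂ} (hf : IntervalIntegrable f volume (-π) π)
    (hg : IntervalIntegrable g volume (-π) π) (n : ℕ) :
    vallPoussin n (f - g) = vallPoussin n f - vallPoussin n g := by
  simp only [vallPoussin, partialSum_sub hf hg, sum_sub_distrib, smul_sub]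

theorem normL_sub_vallPoussin_le {n : ℕ} (hn : n ≠ 0) {f : ℝ → ℂ}
    (hf : IntervalIntegrable f volume (-π) π) :
    normL (f - vallPoussin n f) ≤ 4 * bestApprox n f := by
  rw [← div_le_iff₀' (by norm_num)]
  refine le_ciInf fun c => ?_
  have hT := intervalIntegrable_trigPoly n c
  have hsub : IntervalIntegrable (f - trigPoly n c) volume (-π) π := hf.sub hT
  have reproduce : f - vallPoussin n f =
      (f - trigPoly n c) - vallPoussin n (f - trigPoly n c) := by
    rw [vallPoussin_sub hf hT, vallPoussin_trigPoly hn]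
    abel
  rw [reproduce, div_le_iff₀' (by norm_num)]
  linarith [normL_sub_le hsub (intervalIntegrable_vallPoussin n (f - trigPoly n c)),
    normL_vallPoussin_le hn hsub]

theorem norm_vallPoussin_sub_partialSum_le {n : ℕ} (hn : n ≠ 0) (f : ℝ → ℂ) (x : ℝ) {B : ℝ}
    (hB : ∀ j ∈ Ico n (2 * n), ‖partialSum j f x - partialSum n f x‖ ≤ B) :
    ‖vallPoussin n f x - partialSum n f x‖ ≤ B := by
  have average : vallPoussin n f x - partialSum n f x =
      (n : ℂ)⁻¹ • ∑ j ∈ Ico n (2 * n), (partialSum j f x - partialSum n f x) := by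
    rw [sum_sub_distrib, smul_sub, inv_natCast_smul_sum_Ico_const hn, vallPoussin, Pi.smul_apply,
      Finset.sum_apply]
  calc ‖vallPoussin n f x - partialSum n f x‖ ≤ (n : ℝ)⁻¹ * ∑ _j ∈ Ico n (2 * n), B := by
        rw [average, norm_smul, norm_inv, Complex.norm_natCast]
        gcongr
        exact norm_sum_le_of_le _ hB
    _ = B := by
        rw [sum_const, Nat.card_Ico, two_mul, Nat.add_sub_cancel, nsmul_eq_mul,
          inv_mul_cancel_left₀ (Nat.cast_ne_zero.2 hn)]

theorem bestApprox_le_normL (n : ℕ) (f : ℝ → ℂ) (c : ℤ → ℂ) :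
    bestApprox n f ≤ normL (f - trigPoly n c) :=
  ciInf_le ⟨0, by rintro _ ⟨c, rfl⟩; exact normL_nonneg _⟩ c

theorem bestApprox_nonneg (n : ℕ) (f : ℝ → ℂ) : 0 ≤ bestApprox n f :=
  Real.iInf_nonneg fun _ => normL_nonneg _

/-! ### Sequences of group bounded variation -/

theorem cos_mul_norm_le_re {θ : ℝ} (hθ : θ ≤ π) {z : ℂ} (hz : z ∈ sector θ) :
    Real.cos θ * ‖z‖ ≤ z.re := by
  have hcos : Real.cos θ ≤ Real.cos z.arg := by
    rw [← Real.cos_abs z.arg]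
    exact Real.cos_le_cos_of_nonneg_of_le_pi (abs_nonneg _) hθ hz
  rw [← norm_mul_cos_arg z, mul_comm]
  gcongr

theorem cos_mul_sum_mul_norm_le {ι : Type*} {θ : ℝ} (hθ : θ ≤ π) {s : Finset ι} {w : ι → ℝ}
    (hw : ∀ i ∈ s, 0 ≤ w i) {c : ι → ℂ} (hc : ∀ i ∈ s, c i ∈ sector θ) :
    Real.cos θ * ∑ i ∈ s, w i * ‖c i‖ ≤ ‖∑ i ∈ s, (w i : ℂ) * c i‖ := by
  calc Real.cos θ * ∑ i ∈ s, w i * ‖c i‖ ≤ (∑ i ∈ s, (w i : ℂ) * c i).re := by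
        rw [mul_sum, re_sum]
        refine sum_le_sum fun i hi => ?_
        rw [re_ofReal_mul, mul_left_comm]
        exact mul_le_mul_of_nonneg_left (cos_mul_norm_le_re hθ (hc i hi)) (hw i hi)
    _ ≤ ‖∑ i ∈ s, (w i : ℂ) * c i‖ := re_le_norm _

theorem log_add_one_le_sum_inv (n : ℕ) :
    Real.log (n + 1) ≤ ∑ k ∈ Ico 1 (n + 1), (k : ℝ)⁻¹ := by
  have h := log_add_one_le_harmonic n
  rw [harmonic_eq_sum_Icc, ← Finset.Ico_add_one_right_eq_Icc] at h
  push_cast at h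
  exact h

theorem sum_inv_mul_add_le {a : ℕ → ℝ} (ha : ∀ k, 0 ≤ a k) (n j : ℕ) :
    ∑ k ∈ Ico 1 (n + 1), (k : ℝ)⁻¹ * a (k + j) ≤
      (j + 1) * ∑ k ∈ Ico 1 (n + j + 1), (k : ℝ)⁻¹ * a k := by
  calc ∑ k ∈ Ico 1 (n + 1), (k : ℝ)⁻¹ * a (k + j)
      ≤ ∑ k ∈ Ico 1 (n + 1), (j + 1) * (((k + j : ℕ) : ℝ)⁻¹ * a (k + j)) := by
        refine sum_le_sum fun k hk => ?_
        have one_le_k : (1 : ℝ) ≤ k := by exact_mod_cast (mem_Ico.1 hk).1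
        have k_pos : (0 : ℝ) < k := one_pos.trans_le one_le_k
        rw [← mul_assoc]
        refine mul_le_mul_of_nonneg_right ?_ (ha _)
        rw [Nat.cast_add, ← div_eq_mul_inv, inv_eq_one_div,
          div_le_div_iff₀ k_pos (by positivity)]
        nlinarith [Nat.cast_nonneg (α := ℝ) j]
    _ = (j + 1) * ∑ k ∈ Ico (1 + j) (n + j + 1), (k : ℝ)⁻¹ * a k := by
        rw [← mul_sum, sum_Ico_add' fun k : ℕ => (k : ℝ)⁻¹ * a k, add_right_comm n]
    _ ≤ (j + 1) * ∑ k ∈ Ico 1 (n + j + 1), (k : ℝ)⁻¹ * a k := by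
        refine mul_le_mul_of_nonneg_left (sum_le_sum_of_subset_of_nonneg
          (Ico_subset_Ico_left (by lia)) fun k _ _ => ?_) (by positivity)
        exact mul_nonneg (by positivity) (ha k)

section GroupBV

variable {E : Type*} [SeminormedAddCommGroup E]

theorem norm_sub_le_sum_Icc (c : ℕ → E) {m p q : ℕ} (hp : p ∈ Set.Icc m (2 * m + 1))
    (hq : q ∈ Set.Icc m (2 * m + 1)) :
    ‖c p - c q‖ ≤ ∑ n ∈ Icc m (2 * m), ‖c n - c (n + 1)‖ := by
  wlog hpq : p ≤ q generalizing p q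
  · rw [norm_sub_rev]
    exact this hq hp (le_of_not_ge hpq)
  simp only [← dist_eq_norm]
  refine (dist_le_Ico_sum_dist c hpq).trans (sum_le_sum_of_subset_of_nonneg (fun k hk => ?_)
    fun _ _ _ => dist_nonneg)
  simp only [mem_Ico, mem_Icc, Set.mem_Icc] at *
  lia

theorem coe_sup_nnnorm_le {ι : Type*} {s : Finset ι} {c : ι → E} {D : ℝ} (hD : 0 ≤ D)
    (h : ∀ i ∈ s, ‖c i‖ ≤ D) : ((s.sup fun i => ‖c i‖₊ : ℝ≥0) : ℝ) ≤ D := by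
  lift D to ℝ≥0 using hD
  exact NNReal.coe_le_coe.2 (Finset.sup_le fun i hi => NNReal.coe_le_coe.1 (h i hi))

/-- Group bounded variation: the variation part of the condition `GBV`, with its constants `N₀` and
`M` made explicit and without the restriction to a sector. -/
def GroupBV (N₀ : ℕ) (M : ℝ) (c : ℕ → E) : Prop :=
  ∀ m : ℕ, 1 ≤ m → ∑ n ∈ Icc m (2 * m), ‖c n - c (n + 1)‖ ≤
    M * (((Ico m (m + N₀)).sup fun n => ‖c n‖₊ : ℝ≥0) : ℝ)

namespace GroupBV

variable {N₀ : ℕ} {M : ℝ} {c : ℕ → E}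

theorem norm_le_mul_sum (hc : GroupBV N₀ M c) (hN₀ : 1 ≤ N₀) (hM : 0 ≤ M) {m N : ℕ} (hm : 1 ≤ m)
    (hN : N ∈ Set.Icc m (2 * m + 1)) :
    ‖c N‖ ≤ (1 + M) * ∑ j ∈ range N₀, ‖c (m + j)‖ := by
  set S := ∑ j ∈ range N₀, ‖c (m + j)‖
  have le_window {n : ℕ} (hn : n ∈ Ico m (m + N₀)) : ‖c n‖ ≤ S := by
    rw [mem_Ico] at hn
    have h := single_le_sum (f := fun j => ‖c (m + j)‖) (fun _ _ => norm_nonneg _)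
      (mem_range.2 (by lia : n - m < N₀))
    rwa [Nat.add_sub_cancel' hn.1] at h
  have hS : 0 ≤ S := sum_nonneg fun _ _ => norm_nonneg _
  calc ‖c N‖ ≤ ‖c m‖ + ‖c N - c m‖ := norm_le_norm_add_norm_sub' _ _
    _ ≤ ‖c m‖ + M * S := by
        gcongr
        exact (norm_sub_le_sum_Icc c hN ⟨le_rfl, by lia⟩).trans ((hc m hm).trans
          (by gcongr; exact coe_sup_nnnorm_le hS fun n hn => le_window hn))
    _ ≤ (1 + M) * S := by
        rw [one_add_mul]
        gcongr
        exact le_window (mem_Ico.2 ⟨le_rfl, by lia⟩)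

theorem norm_mul_log_le (hc : GroupBV N₀ M c) (hN₀ : 1 ≤ N₀) (hM : 0 ≤ M) {n N : ℕ} (hn : N₀ ≤ n)
    (hN : N ∈ Set.Icc (2 * n) (2 * n + 1)) :
    ‖c N‖ * Real.log (n + 1) ≤
      (1 + M) * N₀ ^ 2 * ∑ k ∈ Ico 1 (2 * n + 1), (k : ℝ)⁻¹ * ‖c (n + k)‖ := by
  obtain ⟨hN_ge, hN_le⟩ := hN
  set S := ∑ k ∈ Ico 1 (2 * n + 1), (k : ℝ)⁻¹ * ‖c (n + k)‖
  have shifted_sum_le {j : ℕ} (hj : j ∈ range N₀) :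
      ∑ k ∈ Ico 1 (n + 1), (k : ℝ)⁻¹ * ‖c (n + k + j)‖ ≤ N₀ * S := by
    rw [mem_range] at hj
    simp only [add_assoc n]
    refine (sum_inv_mul_add_le (fun k => norm_nonneg (c (n + k))) n j).trans ?_
    refine mul_le_mul (by exact_mod_cast hj) ?_ (by positivity) (by positivity)
    exact sum_le_sum_of_subset_of_nonneg (Ico_subset_Ico_right (by lia)) fun _ _ _ => by positivity
  -- For `1 ≤ k ≤ n` the block `[n + k, 2 * (n + k) + 1]` contains `N`.
  calc ‖c N‖ * Real.log (n + 1) ≤ ∑ k ∈ Ico 1 (n + 1), (k : ℝ)⁻¹ * ‖c N‖ := by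
        rw [← sum_mul, mul_comm]; gcongr; exact log_add_one_le_sum_inv n
    _ ≤ ∑ k ∈ Ico 1 (n + 1), (k : ℝ)⁻¹ * ((1 + M) * ∑ j ∈ range N₀, ‖c (n + k + j)‖) := by
        refine sum_le_sum fun k hk => ?_
        rw [mem_Ico] at hk
        gcongr
        exact hc.norm_le_mul_sum hN₀ hM (by lia) ⟨by lia, by lia⟩
    _ = (1 + M) * ∑ j ∈ range N₀, ∑ k ∈ Ico 1 (n + 1), (k : ℝ)⁻¹ * ‖c (n + k + j)‖ := by
        rw [sum_comm]; simp only [mul_left_comm _ (1 + M), mul_sum]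
    _ ≤ (1 + M) * (N₀ * (N₀ * S)) := by
        gcongr
        simpa only [card_range, nsmul_eq_mul] using
          sum_le_card_nsmul (range N₀) _ _ fun _ hj => shifted_sum_le hj
    _ = (1 + M) * N₀ ^ 2 * S := by ring

end GroupBV

end GroupBV

theorem GroupBV.norm_sum_mul_exp_pow_le {N₀ : ℕ} {M : ℝ} {c : ℕ → ℂ} (hc : GroupBV N₀ M c)
    (hM : 0 ≤ M) {n j : ℕ} (hn : 1 ≤ n) (hj : j ∈ Set.Icc n (2 * n)) {D : ℝ}
    (hD : ∀ k, n ≤ k → ‖c k‖ ≤ D) {x : ℝ} (hx : |x| ≤ π) :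
    ‖∑ k ∈ Ico (n + 1) (j + 1), c k * exp (I * x) ^ k‖ ≤
      (1 + M) * D * ((1 + π) * (n / (1 + n * |x|))) := by
  obtain ⟨hnj, hj⟩ := hj
  have hD_nonneg : 0 ≤ D := (norm_nonneg _).trans (hD n le_rfl)
  have variation_le : ∑ k ∈ Ico (n + 1) (j + 1), ‖c k - c (k + 1)‖ ≤ M * D :=
    calc ∑ k ∈ Ico (n + 1) (j + 1), ‖c k - c (k + 1)‖
        ≤ ∑ k ∈ Icc n (2 * n), ‖c k - c (k + 1)‖ := by
          gcongr
          intro k hk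
          simp only [mem_Ico, mem_Icc] at hk ⊢
          lia
      _ ≤ M * D := (hc n hn).trans (by
          gcongr; exact coe_sup_nnnorm_le hD_nonneg fun k hk => hD k (mem_Ico.1 hk).1)
  refine (norm_sum_Ico_smul_le c _ (by lia : n + 1 ≤ j + 1) fun i hi =>
    norm_sum_exp_pow_le hx (n := n) (by lia)).trans ?_
  refine mul_le_mul_of_nonneg_right ?_ (by positivity)
  rw [one_add_mul]
  exact add_le_add (hD (j + 1) (by lia)) variation_le

/-- The sum `∑_{k=1}^{2n} c_{n+k} / k`: up to sign, the discrete Hilbert transform at `n` of the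
coefficients that remain once `S_n` has been subtracted. -/
noncomputable def hilbertSum (c : ℕ → ℂ) (n : ℕ) : ℂ :=
  ∑ k ∈ Ico 1 (2 * n + 1), (k : ℂ)⁻¹ * c (n + k)

theorem cos_mul_sum_inv_mul_norm_le_norm_hilbertSum {θ : ℝ} (hθ : θ ≤ π) {c : ℕ → ℂ}
    (hc : ∀ n, 1 ≤ n → c n ∈ sector θ) (n : ℕ) :
    Real.cos θ * ∑ k ∈ Ico 1 (2 * n + 1), (k : ℝ)⁻¹ * ‖c (n + k)‖ ≤ ‖hilbertSum c n‖ := by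
  rw [hilbertSum]
  simpa only [ofReal_inv, ofReal_natCast] using
    cos_mul_sum_mul_norm_le hθ (w := fun k : ℕ => (k : ℝ)⁻¹) (fun k _ => by positivity)
      fun k hk => hc (n + k) (by have := (mem_Ico.1 hk).1; lia)

theorem GBV.isBigO_mul_log {c : ℕ → ℂ} (hc : GBV c) :
    (fun N : ℕ => c N * (Real.log N : ℂ)) =O[atTop] fun N => hilbertSum c (N / 2) := by
  obtain ⟨⟨θ, hθ₀, hθ, hsector⟩, N₀, hN₀, M, hM, hvar⟩ := hc
  have hcos : 0 < Real.cos θ := Real.cos_pos_of_mem_Ioo ⟨by linarith, hθ⟩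
  have large : ∀ᶠ N : ℕ in atTop, max 1 N₀ ≤ N / 2 :=
    (Nat.tendsto_div_const_atTop two_ne_zero).eventually_ge_atTop _
  refine IsBigO.of_bound (2 * ((1 + M) * N₀ ^ 2 / Real.cos θ)) ?_
  filter_upwards [large] with N hN
  obtain ⟨n, hn⟩ : ∃ n, N / 2 = n := ⟨_, rfl⟩
  rw [hn] at hN ⊢
  have hmem : N ∈ Set.Icc (2 * n) (2 * n + 1) := ⟨by lia, by lia⟩
  have hlog : Real.log N ≤ 2 * Real.log (n + 1) := by
    have hN_pos : (0 : ℝ) < N := by exact_mod_cast (by lia : 0 < N)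
    have hN_le : (N : ℝ) ≤ (n + 1) ^ 2 := by
      exact_mod_cast hmem.2.trans (by nlinarith : 2 * n + 1 ≤ (n + 1) ^ 2)
    simpa using Real.log_le_log hN_pos hN_le
  rw [norm_mul, norm_real, Real.norm_of_nonneg (Real.log_natCast_nonneg N)]
  calc ‖c N‖ * Real.log N ≤ 2 * (‖c N‖ * Real.log (n + 1)) := by
        rw [mul_left_comm]; gcongr
    _ ≤ 2 * ((1 + M) * N₀ ^ 2 * ∑ k ∈ Ico 1 (2 * n + 1), (k : ℝ)⁻¹ * ‖c (n + k)‖) := by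
        refine mul_le_mul_of_nonneg_left ?_ two_pos.le
        exact GroupBV.norm_mul_log_le hvar hN₀ hM.le (le_of_max_le_right hN) hmem
    _ ≤ 2 * ((1 + M) * N₀ ^ 2 * (‖hilbertSum c n‖ / Real.cos θ)) := by
        gcongr
        rw [le_div_iff₀' hcos]
        exact cos_mul_sum_inv_mul_norm_le_norm_hilbertSum (by linarith [Real.pi_pos]) hsector n
    _ = 2 * ((1 + M) * N₀ ^ 2 / Real.cos θ) * ‖hilbertSum c n‖ := by ring

theorem isBigO_comp_div_two {ψ : ℕ → ℝ} (hψ_anti : Antitone ψ) (hψ_nonneg : ∀ n, 0 ≤ ψ n)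
    (hψ_dbl : ψ =O[atTop] fun n : ℕ => ψ (2 * n)) : (fun n => ψ (n / 2)) =O[atTop] ψ := by
  have quadruple : ψ =O[atTop] fun n : ℕ => ψ (2 * (2 * n)) :=
    hψ_dbl.trans (hψ_dbl.comp_tendsto (tendsto_id.const_mul_atTop' two_pos))
  refine (quadruple.comp_tendsto (Nat.tendsto_div_const_atTop two_ne_zero)).trans
    (IsBigO.of_bound' ?_)
  filter_upwards [eventually_ge_atTop 2] with n hn
  rw [Function.comp_apply, Real.norm_of_nonneg (hψ_nonneg _), Real.norm_of_nonneg (hψ_nonneg _)]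
  exact hψ_anti (by lia)

theorem GBV.isBigO_mul_log_of_hilbertSum {c : ℕ → ℂ} (hc : GBV c) {ψ : ℕ → ℝ}
    (hψ_anti : Antitone ψ) (hψ_nonneg : ∀ n, 0 ≤ ψ n)
    (hψ_dbl : ψ =O[atTop] fun n : ℕ => ψ (2 * n)) (h : hilbertSum c =O[atTop] ψ) :
    (fun n : ℕ => c n * (Real.log n : ℂ)) =O[atTop] ψ :=
  hc.isBigO_mul_log.trans ((h.comp_tendsto (Nat.tendsto_div_const_atTop two_ne_zero)).trans
    (isBigO_comp_div_two hψ_anti hψ_nonneg hψ_dbl))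

theorem exists_norm_le_mul_div_log {c : ℕ → ℂ} {ψ : ℕ → ℝ} (hψ_anti : Antitone ψ)
    (hψ_nonneg : ∀ n, 0 ≤ ψ n) (h : (fun n : ℕ => c n * (Real.log n : ℂ)) =O[atTop] ψ) :
    ∃ C, ∀ᶠ n : ℕ in atTop, ∀ k, n ≤ k → ‖c k‖ ≤ C * (ψ n / Real.log n) := by
  obtain ⟨C, hC, hbound⟩ := h.exists_pos
  refine ⟨C, ?_⟩
  filter_upwards [eventually_forall_ge_atTop.2 hbound.bound, eventually_gt_atTop 1] with
    n hbound hn k hk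
  have hlog_pos : 0 < Real.log n := Real.log_pos (by exact_mod_cast hn)
  have hlog_le : Real.log n ≤ Real.log k :=
    Real.log_le_log (by exact_mod_cast hn.pos) (by exact_mod_cast hk)
  rw [← mul_div_assoc, le_div_iff₀ hlog_pos]
  calc ‖c k‖ * Real.log n ≤ ‖c k‖ * Real.log k := by gcongr
    _ = ‖c k * (Real.log k : ℂ)‖ := by
        rw [norm_mul, norm_real, Real.norm_of_nonneg (hlog_pos.le.trans hlog_le)]
    _ ≤ C * ψ k := (hbound k hk).trans_eq (by rw [Real.norm_of_nonneg (hψ_nonneg k)])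
    _ ≤ C * ψ n := by gcongr; exact hψ_anti hk

/-! ### Convergence in the mean -/

theorem isBigO_cofinite_int_iff {E F : Type*} [SeminormedAddCommGroup E] [SeminormedAddCommGroup F]
    {f : ℤ → E} {g : ℤ → F} :
    f =O[cofinite] g ↔ ((fun n : ℕ => f n) =O[atTop] fun n : ℕ => g n) ∧
      ((fun n : ℕ => f (-n)) =O[atTop] fun n : ℕ => g (-n)) := by
  rw [Int.cofinite_eq, isBigO_sup, and_comm, ← Nat.map_cast_int_atTop, isBigO_map,
    ← Filter.map_neg_atTop, ← Nat.map_cast_int_atTop, isBigO_map, isBigO_map]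
  rfl

section

variable {f : ℝ → ℂ} {ψ : ℕ → ℝ}

theorem fhat_sub_partialSum (hf : IntervalIntegrable f volume (-π) π) (n : ℕ) (k : ℤ) :
    fhat (f - partialSum n f) k = if k ∈ Icc (-(n : ℤ)) n then 0 else fhat f k := by
  rw [partialSum, fhat_sub hf (intervalIntegrable_trigPoly _ _), fhat_trigPoly]
  split_ifs
  · exact sub_self _
  · exact sub_zero _

theorem norm_hilbertSum_fhat_le (hf : IntervalIntegrable f volume (-π) π) (n : ℕ) :
    ‖hilbertSum (fun k => fhat f k) n‖ ≤ (1 + π) / π * normL (f - partialSum n f) := by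
  have hg : IntervalIntegrable (f - partialSum n f) volume (-π) π :=
    hf.sub (intervalIntegrable_trigPoly _ _)
  have h := norm_sum_inv_mul_fhat_sub_le hg (2 * n) n
  rw [sum_Icc_neg_natCast, Int.cast_zero, inv_zero, zero_mul, zero_add] at h
  refine (le_of_eq ?_).trans h
  rw [← norm_neg, hilbertSum, ← sum_neg_distrib]
  refine congrArg _ (sum_congr rfl fun k hk => ?_)
  rw [mem_Ico] at hk
  rw [fhat_sub_partialSum hf, fhat_sub_partialSum hf,
    if_pos (mem_Icc.2 (by lia)), if_neg (by rw [mem_Icc]; lia), sub_neg_eq_add]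
  push_cast
  ring

theorem norm_hilbertSum_fhat_neg_le (hf : IntervalIntegrable f volume (-π) π) (n : ℕ) :
    ‖hilbertSum (fun k => fhat f (-k)) n‖ ≤ (1 + π) / π * normL (f - partialSum n f) := by
  have hg : IntervalIntegrable (f - partialSum n f) volume (-π) π :=
    hf.sub (intervalIntegrable_trigPoly _ _)
  have h := norm_sum_inv_mul_fhat_sub_le hg (2 * n) (-n)
  rw [sum_Icc_neg_natCast, Int.cast_zero, inv_zero, zero_mul, zero_add] at h
  refine (le_of_eq ?_).trans h
  rw [hilbertSum]
  refine congrArg _ (sum_congr rfl fun k hk => ?_)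
  rw [mem_Ico] at hk
  rw [fhat_sub_partialSum hf, fhat_sub_partialSum hf,
    if_neg (by rw [mem_Icc]; lia), if_pos (mem_Icc.2 (by lia)), mul_zero, add_zero]
  push_cast
  rw [neg_add']

theorem norm_trigPoly_sub_trigPoly_le {c : ℤ → ℂ} {N₁ N₂ : ℕ} {M₁ M₂ D₁ D₂ : ℝ}
    (hpos : GroupBV N₁ M₁ fun k : ℕ => c k) (hneg : GroupBV N₂ M₂ fun k : ℕ => c (-k))
    (hM₁ : 0 ≤ M₁) (hM₂ : 0 ≤ M₂) {n j : ℕ} (hn : 1 ≤ n) (hj : j ∈ Set.Icc n (2 * n))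
    (hD₁ : ∀ k : ℕ, n ≤ k → ‖c k‖ ≤ D₁) (hD₂ : ∀ k : ℕ, n ≤ k → ‖c (-k)‖ ≤ D₂)
    {x : ℝ} (hx : |x| ≤ π) :
    ‖trigPoly j c x - trigPoly n c x‖ ≤
      ((1 + M₁) * D₁ + (1 + M₂) * D₂) * ((1 + π) * (n / (1 + n * |x|))) := by
  rw [trigPoly_sub_trigPoly hj.1, add_mul]
  have h_neg := hneg.norm_sum_mul_exp_pow_le hM₂ hn hj hD₂ (x := -x) (by rwa [abs_neg])
  rw [abs_neg] at h_neg
  exact norm_add_le_of_le (hpos.norm_sum_mul_exp_pow_le hM₁ hn hj hD₁ hx) h_neg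

theorem normL_vallPoussin_sub_partialSum_le {N₁ N₂ : ℕ} {M₁ M₂ D₁ D₂ : ℝ}
    (hpos : GroupBV N₁ M₁ fun k : ℕ => fhat f k) (hneg : GroupBV N₂ M₂ fun k : ℕ => fhat f (-k))
    (hM₁ : 0 ≤ M₁) (hM₂ : 0 ≤ M₂) {n : ℕ} (hn : 1 ≤ n)
    (hD₁ : ∀ k : ℕ, n ≤ k → ‖fhat f k‖ ≤ D₁) (hD₂ : ∀ k : ℕ, n ≤ k → ‖fhat f (-k)‖ ≤ D₂) :
    normL (vallPoussin n f - partialSum n f) ≤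
      ((1 + M₁) * D₁ + (1 + M₂) * D₂) * ((1 + π) * (2 * Real.log (1 + n * π))) := by
  have hg : IntervalIntegrable (vallPoussin n f - partialSum n f) volume (-π) π :=
    (intervalIntegrable_vallPoussin n f).sub (intervalIntegrable_trigPoly _ _)
  have hb := (((continuous_div_one_add_mul_abs n.cast_nonneg).const_mul (1 + π)).const_mul
    ((1 + M₁) * D₁ + (1 + M₂) * D₂)).intervalIntegrable (μ := volume) (-π) π
  have h := normL_le_integral hg hb fun x hx =>
    norm_vallPoussin_sub_partialSum_le (by lia) f x fun j hj =>
      norm_trigPoly_sub_trigPoly_le hpos hneg hM₁ hM₂ hn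
        (Set.Ico_subset_Icc_self (Finset.mem_Ico.1 hj)) hD₁ hD₂ (abs_le.2 hx)
  rwa [intervalIntegral.integral_const_mul, intervalIntegral.integral_const_mul,
    integral_div_one_add_mul_abs n.cast_nonneg Real.pi_pos.le] at h

theorem isBigO_normL_vallPoussin_sub_partialSum
    (hpos : GBV fun n : ℕ => fhat f n) (hneg : GBV fun n : ℕ => fhat f (-n))
    (hψ_anti : Antitone ψ) (hψ_nonneg : ∀ n, 0 ≤ ψ n)
    (hlog_pos : (fun n : ℕ => fhat f n * (Real.log n : ℂ)) =O[atTop] ψ)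
    (hlog_neg : (fun n : ℕ => fhat f (-n) * (Real.log n : ℂ)) =O[atTop] ψ) :
    (fun n => normL (vallPoussin n f - partialSum n f)) =O[atTop] ψ := by
  obtain ⟨-, N₁, -, M₁, hM₁, hvar₁⟩ := hpos
  obtain ⟨-, N₂, -, M₂, hM₂, hvar₂⟩ := hneg
  obtain ⟨C₁, hC₁⟩ := exists_norm_le_mul_div_log hψ_anti hψ_nonneg hlog_pos
  obtain ⟨C₂, hC₂⟩ := exists_norm_le_mul_div_log hψ_anti hψ_nonneg hlog_neg
  refine IsBigO.of_bound (((1 + M₁) * C₁ + (1 + M₂) * C₂) * ((1 + π) * 8)) ?_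
  filter_upwards [hC₁, hC₂, eventually_ge_atTop 2] with n hD₁ hD₂ hn
  have hlog : 0 < Real.log n := Real.log_pos (by exact_mod_cast hn)
  have hD₁_nonneg := (norm_nonneg _).trans (hD₁ n le_rfl)
  have hD₂_nonneg := (norm_nonneg _).trans (hD₂ n le_rfl)
  rw [Real.norm_of_nonneg (normL_nonneg _), Real.norm_of_nonneg (hψ_nonneg n)]
  calc normL (vallPoussin n f - partialSum n f)
      ≤ ((1 + M₁) * (C₁ * (ψ n / Real.log n)) + (1 + M₂) * (C₂ * (ψ n / Real.log n))) *
          ((1 + π) * (2 * Real.log (1 + n * π))) :=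
        normL_vallPoussin_sub_partialSum_le hvar₁ hvar₂ hM₁.le hM₂.le (by lia) hD₁ hD₂
    _ ≤ ((1 + M₁) * (C₁ * (ψ n / Real.log n)) + (1 + M₂) * (C₂ * (ψ n / Real.log n))) *
          ((1 + π) * (2 * (4 * Real.log n))) := by
        gcongr
        exact log_one_add_mul_pi_le hn
    _ = ((1 + M₁) * C₁ + (1 + M₂) * C₂) * ((1 + π) * 8) * ψ n := by
        field_simp
        ring

theorem normL_sub_partialSum_le (hf : IntervalIntegrable f volume (-π) π) {n : ℕ} (hn : n ≠ 0) :
    normL (f - partialSum n f) ≤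
      4 * bestApprox n f + normL (vallPoussin n f - partialSum n f) := by
  have hV := intervalIntegrable_vallPoussin n f
  have hS : IntervalIntegrable (partialSum n f) volume (-π) π := intervalIntegrable_trigPoly _ _
  calc normL (f - partialSum n f)
      = normL ((f - vallPoussin n f) - (partialSum n f - vallPoussin n f)) := by
        rw [sub_sub_sub_cancel_right]
    _ ≤ normL (f - vallPoussin n f) + normL (partialSum n f - vallPoussin n f) :=
        normL_sub_le (hf.sub hV) (hS.sub hV)
    _ ≤ 4 * bestApprox n f + normL (vallPoussin n f - partialSum n f) := by
        rw [normL_sub_rev (partialSum n f)]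
        gcongr
        exact normL_sub_vallPoussin_le hn hf

theorem isBigO_bestApprox_of_isBigO_normL (h : (fun n => normL (f - partialSum n f)) =O[atTop] ψ) :
    (fun n => bestApprox n f) =O[atTop] ψ := by
  refine (IsBigO.of_norm_le fun n => ?_).trans h
  rw [Real.norm_of_nonneg (bestApprox_nonneg n f)]
  exact bestApprox_le_normL n f (fhat f)

theorem isBigO_normL_sub_partialSum (hf : IntervalIntegrable f volume (-π) π)
    (hE : (fun n => bestApprox n f) =O[atTop] ψ)
    (hV : (fun n => normL (vallPoussin n f - partialSum n f)) =O[atTop] ψ) :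
    (fun n => normL (f - partialSum n f)) =O[atTop] ψ := by
  refine IsBigO.trans (IsBigO.of_norm_eventuallyLE ?_) ((hE.const_mul_left 4).add hV)
  filter_upwards [eventually_ne_atTop 0] with n hn
  rw [Real.norm_of_nonneg (normL_nonneg _)]
  exact normL_sub_partialSum_le hf hn

end

theorem theorem2_general (f : ℝ → ℂ) (hf : IntervalIntegrable f volume (-π) π)
    (hpos : GBV fun n : ℕ => fhat f (n : ℤ))
    (hneg : GBV fun n : ℕ => fhat f (-(n : ℤ)))
    (ψ : ℕ → ℝ) (hψ_anti : Antitone ψ) (hψ_nonneg : ∀ n, 0 ≤ ψ n)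
    (hψ_dbl : ψ =O[atTop] fun n : ℕ => ψ (2 * n)) :
    ((fun n : ℕ => normL (f - partialSum n f)) =O[atTop] ψ) ↔
      ((fun n : ℕ => bestApprox n f) =O[atTop] ψ) ∧
      ((fun n : ℤ => fhat f n * (Real.log |(n : ℝ)| : ℂ)) =O[cofinite]
        fun n : ℤ => ψ n.natAbs) := by
  rw [isBigO_cofinite_int_iff]
  simp only [Int.natAbs_neg, Int.natAbs_natCast, Int.cast_neg, Int.cast_natCast, abs_neg,
    Nat.abs_cast]
  constructor
  · intro h
    have isBigO_of_le {c : ℕ → ℂ}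
        (hc : ∀ n, ‖hilbertSum c n‖ ≤ (1 + π) / π * normL (f - partialSum n f)) :
        hilbertSum c =O[atTop] ψ := (IsBigO.of_norm_le hc).trans (h.const_mul_left _)
    exact ⟨isBigO_bestApprox_of_isBigO_normL h,
      hpos.isBigO_mul_log_of_hilbertSum hψ_anti hψ_nonneg hψ_dbl
        (isBigO_of_le (norm_hilbertSum_fhat_le hf)),
      hneg.isBigO_mul_log_of_hilbertSum hψ_anti hψ_nonneg hψ_dbl
        (isBigO_of_le (norm_hilbertSum_fhat_neg_le hf))⟩
  · rintro ⟨hE, hlog_pos, hlog_neg⟩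
    exact isBigO_normL_sub_partialSum hf hE
      (isBigO_normL_vallPoussin_sub_partialSum hpos hneg hψ_anti hψ_nonneg hlog_pos hlog_neg)

theorem theorem2 (f : ℝ → ℂ) (hf : MemL2pi f)
    (hpos : GBV fun n : ℕ => fhat f (n : ℤ))
    (hneg : GBV fun n : ℕ => fhat f (-(n : ℤ)))
    (ψ : ℕ → ℝ) (hψ_anti : Antitone ψ) (hψ_lim : Tendsto ψ atTop (nhds 0))
    (hψ_dbl : ψ =O[atTop] fun n : ℕ => ψ (2 * n)) :
    ((fun n : ℕ => normL (f - partialSum n f)) =O[atTop] ψ) ↔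
      ((fun n : ℕ => bestApprox n f) =O[atTop] ψ) ∧
      ((fun n : ℤ => fhat f n * (Real.log |(n : ℝ)| : ℂ)) =O[cofinite]
        fun n : ℤ => ψ n.natAbs) :=
  theorem2_general f hf.integrable hpos hneg ψ hψ_anti
    (fun n => hψ_anti.le_of_tendsto hψ_lim n) hψ_dbl
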